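/- Let $V$ be a complex vector space with a family of elements $\phi(x)\in V$ indexed by labels $x$, let $\mathsf S(V)$ be the free unital commutative algebra on $V$ with the coproduct $\Delta$ that is the algebra morphism determined by $\Delta(\phi)=\phi\otimes 1+1\otimes\phi$ for $\phi\in V$, and let $g\in V\otimes V$ be a symmetric tensor (formally $g=\int dx\,dy\,G_F^{-1}(x,y)\,\phi(x)\otimes\phi(y)$ with $G_F^{-1}$ the inverse propagator). For $i\ne j$ let $R_{i,j}\in\mathsf S(V)^{\otimes v}$ be the element obtained from $g$ by inserting its two legs at the positions $i$ and $j$ (and $1$ elsewhere), and let $R_{i,i}$ be the element obtained by inserting the product of the two legs at the position $i$. Put $T_i:=\tfrac12R_{i,i}:\mathsf S(V)^{\otimes v}\to\mathsf S(V)^{\otimes v}$ (multiplication by $\tfrac12 R_{i,i}$) and $Q_i:=\tfrac12R_{i,i+1}\circ\Delta_i:\mathsf S(V)^{\otimes v}\to\mathsf S(V)^{\otimes (v+1)}$, where $\Delta_i=\mathrm{id}^{\otimes (i-1)}\otimes\Delta\otimes\mathrm{id}^{\otimes (v-i)}$. For $l\ge0$, $v\ge1$ define linear maps $\Omega^{l,v}:\mathsf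 S(V)\to\mathsf S(V)^{\otimes v}$ recursively by $\Omega^{0,1}:=\mathrm{id}$ and, for $(l,v)\ne(0,1)$, $$\Omega^{l,v}:=\frac1{l+v-1}\Big(\sum_{i=1}^{v-1}Q_i\circ\Omega^{l,v-1}+\sum_{i=1}^{v}T_i\circ\Omega^{l-1,v}\Big),$$ where the $Q$ sum is absent for $v=1$ and the $T$ sum is absent for $l=0$. A vertex-ordered graph $\Gamma$ with vertices $1,\dots,v$ and $n$ external edges consists of a finite multiset of internal edges $\{i,j\}$ (multiple edges and self-loops are allowed) and, for every $k=1,\dots,n$, a vertex to which the external edge $k$ is attached. For labels $x_1,\dots,x_n$ it is represented by the element $\Gamma(x_1,\dots,x_n)\in\mathsf S(V)^{\otimes v}$ that is the product of the $R_{i,j}$ over all internal edges and of the $\phi(x_k)$, each at the position of the vertex of the external edge $k$. The symmetry factor of $\Gamma$ is the number of its automorphisms, i.e. of the permutations of the vertices together with permutations of the ends of the internal edges that preserve edges and incidences and fix the external edges. Then, for all integers $l,n\ge 0$ and $v\ge1$, there is a finite family of rational weights $w(\Gamma)$ of vertex-ordered graphs with $v$ vertices and $n$ external edges, which depends only on $l,v,n$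 (not on $V$, $\phi$, $g$ or the labels $x_k$) and vanishes unless $\Gamma$ is connected with $l$ loops, such that $$\Omega^{l,v}(\phi(x_1)\cdots\phi(x_n))=\sum_\Gamma w(\Gamma)\,\Gamma(x_1,\dots,x_n)$$ for all $V$, $\phi$, $g$ and $x_1,\dots,x_n$ as above, and such that for every connected graph with $l$ loops, $v$ vertices and $n$ labeled external edges the total weight, i.e. the sum of $w$ over all vertex-ordered graphs that coincide with it upon forgetting the vertex order, is the inverse of its symmetry factor. -/

import Mathlib

open scoped TensorProduct

noncomputable section

namespace FieldGraph

/-- `S(V)`: the free unital commutative algebra on `V`. Mathlib equips it with the bialgebra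
structure whose coproduct satisfies `Δ(φ) = φ ⊗ 1 + 1 ⊗ φ` for `φ ∈ V`. -/
abbrev S (V : Type*) [AddCommGroup V] [Module ℂ V] : Type _ := SymmetricAlgebra ℂ V

/-- `S(V)^{⊗ v}`, the `v`-fold tensor product algebra. The position `i : Fin v` is vertex `i`. -/
def SPow (V : Type*) [AddCommGroup V] [Module ℂ V] (v : ℕ) : Type _ :=
  PiTensorProduct ℂ (fun _ : Fin v => S V)

instance (V : Type*) [AddCommGroup V] [Module ℂ V] (v : ℕ) : CommRing (SPow V v) :=
  inferInstanceAs (CommRing (PiTensorProduct ℂ (fun _ : Fin v => S V)))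

instance (V : Type*) [AddCommGroup V] [Module ℂ V] (v : ℕ) : Algebra ℂ (SPow V v) :=
  inferInstanceAs (Algebra ℂ (PiTensorProduct ℂ (fun _ : Fin v => S V)))

variable {V : Type*} [AddCommGroup V] [Module ℂ V]

/-- `a ↦ 1 ⊗ ⋯ ⊗ 1 ⊗ a ⊗ 1 ⊗ ⋯ ⊗ 1`, with `a` at position `i`. -/
def atVertex {v : ℕ} (i : Fin v) : S V →ₐ[ℂ] SPow V v :=
  PiTensorProduct.singleAlgHom (R := ℂ) (A := fun _ : Fin v => S V) i

/-- For `g = ∑ K(x, y) φ(x) ⊗ φ(y)`, the element `R i j` is the sum of the elements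
`K(x, y) 1 ⊗ ⋯ ⊗ φ(x) ⊗ ⋯ ⊗ φ(y) ⊗ ⋯ ⊗ 1`, with `φ(x)` at position `i` and `φ(y)` at position `j`;
for `i = j` the product `φ(x) φ(y)` is at position `i`. -/
def R (g : V ⊗[ℂ] V) {v : ℕ} (i j : Fin v) : SPow V v :=
  TensorProduct.lift ((LinearMap.mul ℂ (SPow V v)).compl₁₂
    ((atVertex i).toLinearMap ∘ₗ SymmetricAlgebra.ι ℂ V)
    ((atVertex j).toLinearMap ∘ₗ SymmetricAlgebra.ι ℂ V)) g

/-- The action of `Δ_i` on the `j`-th tensor factor: factors before `i` keep their position, the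
factor `i` is split by the coproduct into positions `i` and `i + 1`, later factors move up by one. -/
def splitFactor {v : ℕ} (i j : Fin v) : S V →ₐ[ℂ] SPow V (v + 1) :=
  if j < i then atVertex j.castSucc
  else if j = i then
    (Algebra.TensorProduct.productMap (atVertex i.castSucc) (atVertex i.succ)).comp
      (Bialgebra.comulAlgHom ℂ (S V))
  else atVertex j.succ

/-- `Δ_i = id^{⊗ (i-1)} ⊗ Δ ⊗ id^{⊗ (v-i)} : S(V)^{⊗ v} → S(V)^{⊗ (v+1)}`. It maps
`a_1 ⊗ ⋯ ⊗ a_v` to the product over `j` of the images of the factors `a_j`. -/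
def coproductAt {v : ℕ} (i : Fin v) : SPow V v →ₐ[ℂ] SPow V (v + 1) :=
  PiTensorProduct.liftAlgHom
    ((MultilinearMap.mkPiAlgebra ℂ (Fin v) (SPow V (v + 1))).compLinearMap
      fun j => (splitFactor i j).toLinearMap)
    (by simp) (fun x y => by simp [Finset.prod_mul_distrib])

/-- `T_i`: multiplication by `(1/2) R_{i,i}`. -/
def T (g : V ⊗[ℂ] V) {v : ℕ} (i : Fin v) : SPow V v →ₗ[ℂ] SPow V v :=
  (1 / 2 : ℂ) • LinearMap.mulLeft ℂ (R g i i)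

/-- `Q_i = (1/2) R_{i,i+1} ∘ Δ_i`. -/
def Q (g : V ⊗[ℂ] V) {v : ℕ} (i : Fin v) : SPow V v →ₗ[ℂ] SPow V (v + 1) :=
  (1 / 2 : ℂ) • (LinearMap.mulLeft ℂ (R g i.castSucc i.succ) ∘ₗ (coproductAt i).toLinearMap)

/-- The maps `Ω^{l,v} : S(V) → S(V)^{⊗ v}` for `v ≥ 1` (the value at `v = 0` is a dummy):
`Ω^{0,1} = id`, and otherwise
`Ω^{l,v} = 1/(l+v-1) (∑_{i=1}^{v-1} Q_i ∘ Ω^{l,v-1} + ∑_{i=1}^{v} T_i ∘ Ω^{l-1,v})`,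
where the `Q` sum is absent for `v = 1` and the `T` sum is absent for `l = 0`. -/
def Omega (g : V ⊗[ℂ] V) : (l v : ℕ) → (S V →ₗ[ℂ] SPow V v)
  | _, 0 => 0
  | 0, 1 => (atVertex 0).toLinearMap
  | 0, v + 2 => (1 / ((v : ℂ) + 1)) • ∑ i : Fin (v + 1), Q g i ∘ₗ Omega g 0 (v + 1)
  | l + 1, v + 1 => (1 / ((l : ℂ) + v + 1)) •
      (∑ i : Fin v, Q g i ∘ₗ Omega g (l + 1) v + ∑ i : Fin (v + 1), T g i ∘ₗ Omega g l (v + 1))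
  termination_by l v => l + v

/-- A vertex-ordered graph with vertices `Fin v` and `n` labeled external edges: a finite multiset
of internal edges (multiple edges and self-loops allowed) and, for every label `k`, the vertex to
which the external edge `k` is attached. -/
@[ext]
structure OrderedGraph (v n : ℕ) where
  edges : Multiset (Sym2 (Fin v))
  leg : Fin n → Fin v

namespace OrderedGraph

variable {v n : ℕ}

/-- The element of `S(V)^{⊗ v}` representing a graph: the product of `R_{i,j}` over all internal
edges `{i, j}`, `i ≤ j`, times, for every external edge `k`, the field operator `f k` at the
position of its vertex. -/
def toTensor (g : V ⊗[ℂ] V) (f : Fin n → V) (Γ : OrderedGraph v n) : SPow V v :=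
  (Γ.edges.map fun e => R g e.inf e.sup).prod *
    ∏ k, atVertex (Γ.leg k) (SymmetricAlgebra.ι ℂ V (f k))

/-- The simple graph of adjacency of distinct vertices. -/
def toSimpleGraph (Γ : OrderedGraph v n) : SimpleGraph (Fin v) :=
  SimpleGraph.fromEdgeSet {e | e ∈ Γ.edges}

def Connected (Γ : OrderedGraph v n) : Prop := Γ.toSimpleGraph.Connected

/-- The number of independent loops: internal edges − vertices + connected components. -/
def loopNumber (Γ : OrderedGraph v n) : ℤ :=
  (Multiset.card Γ.edges : ℤ) - v + Nat.card Γ.toSimpleGraph.ConnectedComponent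

/-- Two vertex-ordered graphs are the same graph up to the ordering of the vertices. The labels of
the external edges are kept. -/
def Iso (Γ Γ' : OrderedGraph v n) : Prop :=
  ∃ σ : Equiv.Perm (Fin v),
    Γ'.edges = Γ.edges.map (Sym2.map σ) ∧ ∀ k, Γ'.leg k = σ (Γ.leg k)

/-- The ends of the internal edges: every edge, counted with multiplicity, has two ends. -/
abbrev HalfEdge (Γ : OrderedGraph v n) : Type := Γ.edges.ToType × Bool

/-- The vertex at which an end of an internal edge is attached. -/
def endpoint (Γ : OrderedGraph v n) (h : Γ.HalfEdge) : Fin v :=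
  if h.2 then h.1.1.sup else h.1.1.inf

/-- The automorphisms of a graph: permutations of the vertices and of the ends of the internal edges
that map edges to edges, respect the attachment of ends to vertices and fix the external edges. -/
def automorphisms (Γ : OrderedGraph v n) :
    Set (Equiv.Perm (Fin v) × Equiv.Perm Γ.HalfEdge) :=
  {p | (∀ e b, p.2 (e, !b) = ((p.2 (e, b)).1, !(p.2 (e, b)).2)) ∧
       (∀ h, Γ.endpoint (p.2 h) = p.1 (Γ.endpoint h)) ∧
       ∀ k, p.1 (Γ.leg k) = Γ.leg k}

/-- The symmetry factor: the number of automorphisms. -/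
def symmetryFactor (Γ : OrderedGraph v n) : ℕ := Nat.card Γ.automorphisms

open Classical in
/-- Let `w` be a finite formal linear combination of vertex-ordered graphs. The weight in `w` of `Γ`,
as an unordered graph, is the sum of the weights of all vertex-ordered graphs that agree with `Γ`
upon forgetting the vertex order. -/
def unorderedWeight (w : OrderedGraph v n →₀ ℚ) (Γ : OrderedGraph v n) : ℚ :=
  ∑ Γ' ∈ w.support with Γ.Iso Γ', w Γ'

end OrderedGraph

end FieldGraph

end

/-! Each `T` or `Q` adds exactly one internal edge, so `Ω^{l,v}` produces graphs with `m = l + v -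
1` internal edges and its prefactor is `1/m`. The expansion is carried out over sequences of `m`
oriented edges instead of graphs: a split vertex distributes every edge end attached to it
independently, so no multiplicities appear. By `Omega_prod` the coefficient of a sequence is
`weight`: undo the last insertion, which was either a self-loop or an edge `(i, i+1)` to be
contracted, at the cost of a factor `1/(2m)`.

The weight of a single sequence depends on the vertex order, but its sum over all `v!` relabelings
does not. For a connected sequence it is `1/(2^m m!)` (`sum_weight_map`): if the last edge joins `a
≠ b`, the orders in which `b` comes directly after `a` correspond to the orders of the contracted
graph; if it is a self-loop, deleting it leaves all orders available.

The permutations of vertices, of edges and of the two ends of each edge form a group of order `v!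
2^m m!`. It acts on attachments of half-edges; its orbits are isomorphism classes of graphs and its
stabilizers are automorphism groups. Hence an unordered graph has `v! 2^m m! / symmetryFactor`
representing sequences (`card_iso_mul_symmetryFactor`). Averaging the weight over relabelings gives
total weight `1/symmetryFactor`. -/

noncomputable section

namespace FieldGraph

/-! ### Tensors of edge sequences and their behaviour under the coproduct -/

section Algebra

variable {V : Type*} [AddCommGroup V] [Module ℂ V]

theorem R_tmul {v : ℕ} (a b : Fin v) (x y : V) :
    R (x ⊗ₜ[ℂ] y) a b =
      atVertex a (SymmetricAlgebra.ι ℂ V x) * atVertex b (SymmetricAlgebra.ι ℂ V y) := by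
  simp [R]

theorem R_zero {v : ℕ} (a b : Fin v) : R (0 : V ⊗[ℂ] V) a b = 0 := by
  simp [R]

theorem R_add {v : ℕ} (g h : V ⊗[ℂ] V) (a b : Fin v) : R (g + h) a b = R g a b + R h a b := by
  simp [R]

theorem R_comm {v : ℕ} (g : V ⊗[ℂ] V) (a b : Fin v) :
    R (TensorProduct.comm ℂ V V g) a b = R g b a := by
  induction g using TensorProduct.induction_on with
  | zero => simp [R_zero]
  | tmul x y => rw [TensorProduct.comm_tmul, R_tmul, R_tmul, mul_comm]
  | add x y hx hy => rw [map_add, R_add, R_add, hx, hy]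

theorem coproductAt_atVertex {v : ℕ} (i j : Fin v) (a : S V) :
    coproductAt i (atVertex j a) = splitFactor i j a := by
  have h : coproductAt i (atVertex j a) =
      ∏ k, splitFactor i k ((MonoidHom.mulSingle (fun _ : Fin v => S V) j a) k) := by
    refine (PiTensorProduct.lift.tprod (R := ℂ) (s := fun _ : Fin v => S V)
      (MonoidHom.mulSingle (fun _ : Fin v => S V) j a)).trans ?_
    simp
  rw [h, Finset.prod_eq_single j]
  · simp
  · intro b _ hb
    simp [Pi.mulSingle_eq_of_ne hb]
  · simp

theorem predAbove_eq_iff {v : ℕ} (i j : Fin v) (k : Fin (v + 1)) :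
    i.predAbove k = j ↔ if j < i then k = j.castSucc
      else if j = i then k = i.castSucc ∨ k = i.succ else k = j.succ := by
  have h : (i.predAbove k : ℕ) = if (i : ℕ) < k then (k : ℕ) - 1 else k := by
    rw [Fin.predAbove]
    by_cases hk : i.castSucc < k
    · rw [dif_pos hk, if_pos (by exact hk)]
      simp
    · rw [dif_neg hk, if_neg (by exact hk)]
      simp
  simp only [Fin.ext_iff, Fin.lt_def, Fin.val_castSucc, Fin.val_succ, h]
  split_ifs <;> omega

/-- Elements of `V` are primitive, so splitting `i` sums over the positions that the contraction
`i.predAbove` sends to `j`. Everything about `Δ_i` on graphs follows by multiplicativity. -/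
theorem coproductAt_atVertex_ι {v : ℕ} (i j : Fin v) (x : V) :
    coproductAt i (atVertex j (SymmetricAlgebra.ι ℂ V x)) =
      ∑ k with i.predAbove k = j, atVertex k (SymmetricAlgebra.ι ℂ V x) := by
  rw [coproductAt_atVertex, splitFactor]
  simp only [predAbove_eq_iff]
  split_ifs with h1 h2
  · simp [Finset.filter_eq']
  · rw [Finset.filter_or, Finset.filter_eq', Finset.filter_eq', Finset.sum_union]
    · simp
    · simp [Fin.ext_iff]
  · simp [Finset.filter_eq']

/-- Splitting the vertex `i` sums over the preimages of an oriented edge under the contraction of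
`i` and `i + 1`. -/
theorem coproductAt_R {v : ℕ} (g : V ⊗[ℂ] V) (i a b : Fin v) :
    coproductAt i (R g a b) =
      ∑ p : Fin (v + 1) × Fin (v + 1) with Prod.map i.predAbove i.predAbove p = (a, b),
        R g p.1 p.2 := by
  induction g using TensorProduct.induction_on with
  | zero => simp [R_zero]
  | tmul x y =>
    simp only [R_tmul, map_mul, coproductAt_atVertex_ι, Finset.sum_mul_sum]
    rw [← Finset.sum_product', ← Finset.filter_product, Finset.univ_product_univ]
    simp [Prod.ext_iff]
  | add x y hx hy => simp only [R_add, map_add, hx, hy, Finset.sum_add_distrib]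

/-- The tensor of the graph with oriented edges `e` in a fixed order and external edges at the
vertices `leg k`. -/
def edgeTensor (g : V ⊗[ℂ] V) {m v n : ℕ} (f : Fin n → V) (e : Fin m → Fin v × Fin v)
    (leg : Fin n → Fin v) : SPow V v :=
  (∏ i, R g (e i).1 (e i).2) * ∏ k, atVertex (leg k) (SymmetricAlgebra.ι ℂ V (f k))

theorem edgeTensor_cons (g : V ⊗[ℂ] V) {m v n : ℕ} (f : Fin n → V) (p : Fin v × Fin v)
    (e : Fin m → Fin v × Fin v) (leg : Fin n → Fin v) :
    edgeTensor g f (Fin.cons p e : Fin (m + 1) → Fin v × Fin v) leg =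
      R g p.1 p.2 * edgeTensor g f e leg := by
  simp [edgeTensor, Fin.prod_univ_succ, mul_assoc]

theorem coproductAt_edgeTensor (g : V ⊗[ℂ] V) {m v n : ℕ} (f : Fin n → V) (i : Fin v)
    (e : Fin m → Fin v × Fin v) (leg : Fin n → Fin v) :
    coproductAt i (edgeTensor g f e leg) =
      ∑ e' : Fin m → Fin (v + 1) × Fin (v + 1)
        with (fun j => Prod.map i.predAbove i.predAbove (e' j)) = e,
      ∑ leg' : Fin n → Fin (v + 1) with (fun k => i.predAbove (leg' k)) = leg,
        edgeTensor g f e' leg' := by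
  simp only [edgeTensor, map_mul, map_prod, coproductAt_atVertex_ι, coproductAt_R,
    Finset.prod_univ_sum, Finset.sum_mul_sum, Prod.mk.eta]
  refine Finset.sum_congr ?_ fun e' _ => Finset.sum_congr ?_ fun leg' _ => rfl
  · ext; simp [Fintype.mem_piFinset, funext_iff]
  · ext; simp [Fintype.mem_piFinset, funext_iff]

end Algebra

/-! ### Expansion of `Omega` over sequences of oriented edges -/

/-- The coefficient with which the graph with oriented edges `e 0, e 1, …` is generated. The edge
`e 0` is the one inserted last. -/
def weight : (m v : ℕ) → (Fin m → Fin v × Fin v) → ℚ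
  | 0, v, _ => if v = 1 then 1 else 0
  | _ + 1, 0, _ => 0
  | m + 1, v + 1, e => (1 / (2 * ((m : ℚ) + 1))) *
      ((if (e 0).1 = (e 0).2 then weight m (v + 1) (Fin.tail e) else 0) +
        ∑ i : Fin v, if e 0 = (i.castSucc, i.succ) then
          weight m v (fun j => Prod.map i.predAbove i.predAbove (Fin.tail e j)) else 0)

theorem weight_cons (m v : ℕ) (p : Fin (v + 1) × Fin (v + 1))
    (e : Fin m → Fin (v + 1) × Fin (v + 1)) :
    weight (m + 1) (v + 1) (Fin.cons p e) = (1 / (2 * ((m : ℚ) + 1))) *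
      ((if p.1 = p.2 then weight m (v + 1) e else 0) +
        ∑ i : Fin v, if p = (i.castSucc, i.succ) then
          weight m v (fun j => Prod.map i.predAbove i.predAbove (e j)) else 0) := by
  rw [weight, Fin.tail_cons, Fin.cons_zero]

/-- Starting from one vertex, each insertion creates at most one new vertex. -/
theorem weight_eq_zero (m v : ℕ) (h : m + 1 < v) (e : Fin m → Fin v × Fin v) :
    weight m v e = 0 := by
  induction m generalizing v with
  | zero => rw [weight, if_neg (by omega)]
  | succ m ih =>
    obtain _ | v := v
    · omega
    rw [weight, ih _ (by omega), Finset.sum_eq_zero fun i _ => ?_]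
    · simp
    · rw [ih _ (by omega), ite_self]

section Algebra

variable {V : Type*} [AddCommGroup V] [Module ℂ V]

/-- The sum of all graphs with `m` edges and `v` vertices, weighted by `weight`. -/
def weightedSum (g : V ⊗[ℂ] V) {n : ℕ} (f : Fin n → V) (m v : ℕ) : SPow V v :=
  ∑ e : Fin m → Fin v × Fin v, ∑ leg : Fin n → Fin v,
    (weight m v e : ℂ) • edgeTensor g f e leg

theorem T_weightedSum (g : V ⊗[ℂ] V) {n : ℕ} (f : Fin n → V) (m v : ℕ) (i : Fin v) :
    T g i (weightedSum g f m v) = (1 / 2 : ℂ) • ∑ e : Fin m → Fin v × Fin v,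
      ∑ leg : Fin n → Fin v, (weight m v e : ℂ) •
        edgeTensor g f (Fin.cons (i, i) e : Fin (m + 1) → Fin v × Fin v) leg := by
  simp only [T, weightedSum, edgeTensor_cons, LinearMap.smul_apply, map_sum, map_smul,
    LinearMap.mulLeft_apply, Finset.smul_sum, smul_comm (1 / 2 : ℂ)]

theorem Q_weightedSum (g : V ⊗[ℂ] V) {n : ℕ} (f : Fin n → V) (m v : ℕ) (i : Fin v) :
    Q g i (weightedSum g f m v) =
      (1 / 2 : ℂ) • ∑ e : Fin m → Fin (v + 1) × Fin (v + 1), ∑ leg : Fin n → Fin (v + 1),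
        (weight m v (fun j => Prod.map i.predAbove i.predAbove (e j)) : ℂ) •
          edgeTensor g f (Fin.cons (i.castSucc, i.succ) e :
            Fin (m + 1) → Fin (v + 1) × Fin (v + 1)) leg := by
  simp only [Q, weightedSum, edgeTensor_cons, LinearMap.smul_apply, LinearMap.comp_apply,
    AlgHom.toLinearMap_apply, map_sum, map_smul, coproductAt_edgeTensor,
    LinearMap.mulLeft_apply]
  simp_rw [smul_comm _ (1 / 2 : ℂ), ← Finset.smul_sum]
  congr 1
  -- Every sequence on `v + 1` vertices occurs once, in the fibre over its contraction, and its
  -- coefficient is the weight of that contraction.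
  refine Eq.trans ?_ (Finset.sum_fiberwise Finset.univ
    (fun (e : Fin m → Fin (v + 1) × Fin (v + 1)) j =>
      Prod.map i.predAbove i.predAbove (e j)) _)
  refine Finset.sum_congr rfl fun e _ => ?_
  rw [Finset.sum_comm, Finset.smul_sum]
  refine Finset.sum_congr rfl fun e' he' => ?_
  rw [Finset.sum_fiberwise, (Finset.mem_filter.1 he').2]

/-- The recursion of `Omega` with the number of edges in place of the loop number. The first entry
of a sequence is separated off: `Q g i` forces it to be `(i.castSucc, i.succ)`, `T g i` forces it to
be `(i, i)`. -/
theorem weightedSum_succ (g : V ⊗[ℂ] V) {n : ℕ} (f : Fin n → V) (m v : ℕ) :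
    weightedSum g f (m + 1) (v + 1) = (1 / ((m : ℂ) + 1)) •
      (∑ i, Q g i (weightedSum g f m v) + ∑ i, T g i (weightedSum g f m (v + 1))) := by
  have key (p : Fin (v + 1) × Fin (v + 1)) (e : Fin m → Fin (v + 1) × Fin (v + 1))
      (x : SPow V (v + 1)) :
      (weight (m + 1) (v + 1) (Fin.cons p e) : ℂ) • x =
        (∑ i : Fin v, if p = (i.castSucc, i.succ) then
          (1 / ((m : ℂ) + 1)) • (1 / 2 : ℂ) •
            (weight m v (fun j => Prod.map i.predAbove i.predAbove (e j)) : ℂ) • x else 0) +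
        if p.1 = p.2 then
          (1 / ((m : ℂ) + 1)) • (1 / 2 : ℂ) • (weight m (v + 1) e : ℂ) • x else 0 := by
    have hc : (1 / (2 * ((m : ℂ) + 1))) = 1 / ((m : ℂ) + 1) * (1 / 2) := by
      rw [one_div_mul_one_div, mul_comm]
    rw [weight_cons, add_comm (ite _ _ _)]
    push_cast
    rw [hc, mul_add, add_smul, Finset.mul_sum, Finset.sum_smul]
    congr 1
    · refine Finset.sum_congr rfl fun i _ => ?_
      split_ifs <;> simp [smul_smul, mul_assoc]
    · split_ifs <;> simp [smul_smul, mul_assoc]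
  have swap (F : Fin (v + 1) × Fin (v + 1) → (Fin m → Fin (v + 1) × Fin (v + 1)) →
      (Fin n → Fin (v + 1)) → Fin v → SPow V (v + 1)) :
      ∑ p, ∑ e, ∑ leg, ∑ i, F p e leg i = ∑ i, ∑ p, ∑ e, ∑ leg, F p e leg i := by
    rw [Finset.sum_comm (γ := Fin v)]
    refine Finset.sum_congr rfl fun p _ => ?_
    rw [Finset.sum_comm (γ := Fin v)]
    exact Finset.sum_congr rfl fun e _ => Finset.sum_comm
  rw [weightedSum, ← (Fin.consEquiv fun _ => Fin (v + 1) × Fin (v + 1)).sum_comp,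
    Fintype.sum_prod_type]
  change ∑ p, ∑ e : Fin m → Fin (v + 1) × Fin (v + 1), ∑ leg,
    (weight (m + 1) (v + 1) (Fin.cons p e) : ℂ) • edgeTensor g f (Fin.cons p e) leg = _
  simp only [key, Finset.sum_add_distrib, smul_add, swap, T_weightedSum, Q_weightedSum,
    Finset.smul_sum]
  congr 1
  · refine Finset.sum_congr rfl fun i _ => ?_
    rw [Finset.sum_eq_single (i.castSucc, i.succ)]
    · simp only [if_true]
    · intro p _ hp
      simp only [if_neg hp, Finset.sum_const_zero]
    · simp
  · rw [Fintype.sum_prod_type]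
    refine Finset.sum_congr rfl fun a _ => ?_
    rw [Finset.sum_eq_single a]
    · simp only [if_true]
    · intro b _ hb
      simp only [if_neg hb.symm, Finset.sum_const_zero]
    · simp

theorem weightedSum_eq_zero (g : V ⊗[ℂ] V) {n : ℕ} (f : Fin n → V) (m v : ℕ) (h : m + 1 < v) :
    weightedSum g f m v = 0 := by
  simp [weightedSum, weight_eq_zero m v h]

theorem Omega_prod (g : V ⊗[ℂ] V) {n : ℕ} (f : Fin n → V) (m l v : ℕ) (h : l + v = m + 1) :
    Omega g l v (∏ k, SymmetricAlgebra.ι ℂ V (f k)) =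
      if v = 0 then 0 else weightedSum g f m v := by
  induction m generalizing l v with
  | zero =>
    obtain ⟨rfl, rfl⟩ | ⟨rfl, rfl⟩ : (l = 0 ∧ v = 1) ∨ (l = 1 ∧ v = 0) := by omega
    · simp [Omega, weightedSum, weight, edgeTensor, map_prod]
    · simp [Omega]
  | succ m ih =>
    match l, v, h with
    | _, 0, _ => simp [Omega]
    | 0, 1, h => omega
    | 0, v + 2, h =>
      obtain rfl : m = v := by omega
      -- For `l = 0` the recursion has no `T` sum; in `weightedSum_succ` it is present but zero,
      -- since `m` edges cannot connect `m + 2` vertices.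
      rw [if_neg (by omega), weightedSum_succ, Omega, weightedSum_eq_zero g f m (m + 2) (by omega)]
      simp [ih 0 (m + 1) (by omega), LinearMap.sum_apply]
    | l + 1, v + 1, h =>
      have hm : (l : ℂ) + v + 1 = m + 1 := by
        norm_cast
        omega
      rw [if_neg (by omega), weightedSum_succ, Omega, hm]
      simp only [LinearMap.smul_apply, LinearMap.add_apply, LinearMap.sum_apply,
        LinearMap.comp_apply, ih (l + 1) v (by omega), ih l (v + 1) (by omega)]
      -- For `v = 0` the `Q` sum is empty, so the dummy value of `Omega` at zero vertices plays no
      -- role.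
      obtain _ | v := v <;> simp

end Algebra

/-! ### Connectedness of weighted sequences and the sum over vertex orders -/

section Combinatorics

/-- Connectedness: there is a vertex, and every property of vertices that is constant along the
edges is constant. -/
def EdgeConnected {E : Type*} {v : ℕ} (e : E → Fin v × Fin v) : Prop :=
  0 < v ∧ ∀ c : Fin v → Prop, (∀ i, c (e i).1 ↔ c (e i).2) → ∀ x y, c x ↔ c y

theorem EdgeConnected.map_surjective {E : Type*} {v v' : ℕ} {e : E → Fin v × Fin v}
    (h : EdgeConnected e) {c : Fin v → Fin v'} (hc : Function.Surjective c) :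
    EdgeConnected fun i => Prod.map c c (e i) := by
  refine ⟨Fin.pos (c ⟨0, h.1⟩), fun d hd x y => ?_⟩
  obtain ⟨x, rfl⟩ := hc x
  obtain ⟨y, rfl⟩ := hc y
  exact h.2 (fun z => d (c z)) hd x y

theorem EdgeConnected.of_cons_self {m v : ℕ} {p : Fin v × Fin v} {e : Fin m → Fin v × Fin v}
    (h : EdgeConnected (Fin.cons p e : Fin (m + 1) → Fin v × Fin v)) (hp : p.1 = p.2) :
    EdgeConnected e := by
  refine ⟨h.1, fun d hd => h.2 d fun i => ?_⟩
  refine Fin.cases ?_ (fun i => ?_) i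
  · rw [Fin.cons_zero, hp]
  · rw [Fin.cons_succ]
    exact hd i

theorem EdgeConnected.map_of_cons {m v v' : ℕ} {p : Fin v × Fin v} {e : Fin m → Fin v × Fin v}
    (h : EdgeConnected (Fin.cons p e : Fin (m + 1) → Fin v × Fin v)) {c : Fin v → Fin v'}
    (hc : Function.Surjective c) (hp : c p.1 = c p.2) :
    EdgeConnected fun i => Prod.map c c (e i) := by
  have h' := h.map_surjective hc
  have : (fun i => Prod.map c c ((Fin.cons p e : Fin (m + 1) → Fin v × Fin v) i)) =
      Fin.cons (Prod.map c c p) fun i => Prod.map c c (e i) := by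
    ext i : 1
    refine Fin.cases ?_ (fun i => ?_) i <;> simp
  rw [this] at h'
  exact h'.of_cons_self hp

theorem edgeConnected_of_weight_ne_zero {m v : ℕ} {e : Fin m → Fin v × Fin v}
    (h : weight m v e ≠ 0) : EdgeConnected e := by
  induction m generalizing v with
  | zero =>
    rw [weight] at h
    obtain rfl : v = 1 := by
      by_contra hv
      exact h (if_neg hv)
    exact ⟨one_pos, fun c _ x y => by rw [Subsingleton.elim x y]⟩
  | succ m ih =>
    obtain _ | v := v
    · exact absurd rfl h
    rw [weight] at h
    obtain h | h := ne_or_eq (if (e 0).1 = (e 0).2 then weight m (v + 1) (Fin.tail e) else 0) 0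
    · have hc := ih (ite_ne_right_iff.1 h).2
      exact ⟨hc.1, fun d hd => hc.2 d fun i => hd i.succ⟩
    · rename_i h0
      rw [h, zero_add] at h0
      obtain ⟨i, _, hi⟩ := Finset.exists_ne_zero_of_sum_ne_zero (right_ne_zero_of_mul h0)
      obtain ⟨he, hw⟩ := ite_ne_right_iff.1 hi
      refine ⟨v.succ_pos, fun d hd => ?_⟩
      -- This composite moves only `i.castSucc`, to the other end `i.succ` of the edge `e 0`, where
      -- `d` agrees. So `d` descends to the contracted graph.
      have key (x : Fin (v + 1)) : d (i.castSucc.succAbove (i.predAbove x)) ↔ d x := by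
        by_cases hx : x = i.castSucc
        · subst hx
          rw [Fin.predAbove_castSucc_self, Fin.succAbove_castSucc_self]
          simpa [he] using (hd 0).symm
        · rw [Fin.succAbove_predAbove hx]
      intro x y
      rw [← key x, ← key y]
      refine (ih hw).2 (fun z => d (i.castSucc.succAbove z)) (fun j => ?_) _ _
      exact (key _).trans ((hd j.succ).trans (key _).symm)

/-- The permutation that maps `a` to `p` and acts on the complements as `τ`. -/
def extendPerm {v : ℕ} (a p : Fin (v + 1)) (τ : Equiv.Perm (Fin v)) : Equiv.Perm (Fin (v + 1)) :=
  (finSuccEquiv' a).trans ((Equiv.optionCongr τ).trans (finSuccEquiv' p).symm)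

@[simp]
theorem extendPerm_self {v : ℕ} (a p : Fin (v + 1)) (τ : Equiv.Perm (Fin v)) :
    extendPerm a p τ a = p := by
  simp [extendPerm]

@[simp]
theorem extendPerm_succAbove {v : ℕ} (a p : Fin (v + 1)) (τ : Equiv.Perm (Fin v)) (j : Fin v) :
    extendPerm a p τ (a.succAbove j) = p.succAbove (τ j) := by
  simp [extendPerm]

theorem extendPerm_bijective {v : ℕ} (a : Fin (v + 1)) :
    Function.Bijective fun q : Fin (v + 1) × Equiv.Perm (Fin v) => extendPerm a q.1 q.2 := by
  rw [Fintype.bijective_iff_injective_and_card]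
  constructor
  · rintro ⟨p, τ⟩ ⟨p', τ'⟩ h
    have h : extendPerm a p τ = extendPerm a p' τ' := h
    obtain rfl : p = p' := by simpa using congrArg (· a) h
    congr 1
    ext1 j
    simpa using congrArg (· (a.succAbove j)) h
  · simp [Fintype.card_perm, Nat.factorial_succ]

theorem sum_extendPerm {v : ℕ} (a : Fin (v + 1)) (F : Equiv.Perm (Fin (v + 1)) → ℚ) :
    ∑ σ, F σ = ∑ τ, ∑ p, F (extendPerm a p τ) := by
  rw [← (extendPerm_bijective a).sum_comp, Fintype.sum_prod_type, Finset.sum_comm]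

/-- If `a` is placed directly before `b = a.succAbove j`, contracting these neighbours after
relabeling equals first merging `a` into `b` (this is `Fin.insertNth a j id`) and then relabeling by
`τ`. -/
theorem predAbove_extendPerm {v : ℕ} (a : Fin (v + 1)) (j : Fin v) (τ : Equiv.Perm (Fin v))
    (x : Fin (v + 1)) : (τ j).predAbove (extendPerm a (τ j).castSucc τ x) =
      τ (Fin.insertNth (α := fun _ => Fin v) a j id x) := by
  obtain rfl | ⟨y, rfl⟩ := Fin.eq_self_or_eq_succAbove a x
  · simp
  · simp [Fin.predAbove_succAbove]

theorem sum_weight_map {m v : ℕ} {e : Fin m → Fin v × Fin v} (h : EdgeConnected e) :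
    ∑ σ : Equiv.Perm (Fin v), weight m v (fun i => Prod.map σ σ (e i)) =
      1 / (2 ^ m * (m.factorial : ℚ)) := by
  induction m generalizing v with
  | zero =>
    obtain rfl : v = 1 := by
      have := h.2 (· = ⟨0, h.1⟩) (fun i => i.elim0)
      have h0 := h.1
      by_contra hv
      have := (this ⟨0, h.1⟩ ⟨1, by omega⟩).1 rfl
      simp at this
    simp [weight]
  | succ m ih =>
    obtain _ | v := v
    · exact absurd h.1 (lt_irrefl 0)
    -- The last insertion contributes `1/2` from `T` or `Q` and `1/(m+1)` from the prefactor of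
    -- `Omega`.
    have hm : 1 / (2 ^ (m + 1) * ((m + 1).factorial : ℚ)) =
        1 / (2 * ((m : ℚ) + 1)) * (1 / (2 ^ m * (m.factorial : ℚ))) := by
      rw [Nat.factorial_succ]
      push_cast
      field_simp
      ring
    rw [← Fin.cons_self_tail e] at h
    simp only [weight]
    rw [← Finset.mul_sum, hm]
    congr 1
    by_cases hab : (e 0).1 = (e 0).2
    · rw [← ih (h.of_cons_self hab)]
      refine Finset.sum_congr rfl fun σ _ => ?_
      rw [Finset.sum_eq_zero, add_zero, if_pos]
      · rfl
      · simp [hab]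
      · intro i _
        refine if_neg fun hi => ?_
        have h1 : σ (e 0).1 = i.castSucc := congrArg Prod.fst hi
        have h2 : σ (e 0).2 = i.succ := congrArg Prod.snd hi
        rw [hab, h2] at h1
        exact (Fin.castSucc_lt_succ (i := i)).ne' h1
    · obtain ⟨j, hj⟩ := Fin.exists_succAbove_eq (Ne.symm hab)
      set a := (e 0).1 with ha
      have hsurj : Function.Surjective (Fin.insertNth (α := fun _ => Fin v) a j id) :=
        fun x => ⟨a.succAbove x, by simp⟩
      rw [← ih (h.map_of_cons hsurj (by simp [← ha, ← hj])), sum_extendPerm a]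
      refine Finset.sum_congr rfl fun τ _ => ?_
      -- Once the order `τ` of the vertices other than `a` is fixed, exactly one position of `a`
      -- makes the edge run from a vertex to its immediate successor.
      rw [Finset.sum_eq_single (τ j).castSucc]
      · rw [if_neg (by exact fun h0 => hab (Equiv.injective _ h0)), zero_add, Finset.sum_eq_single (τ j)]
        · rw [if_pos]
          · congr 1
            ext i : 1
            simp [Fin.tail, Prod.map, predAbove_extendPerm]
          · simp [Prod.map, ← ha, ← hj]
        · intro i _ hi
          refine if_neg fun h0 => hi ?_
          have h1 : (τ j).castSucc = i.castSucc := by simpa [← ha] using congrArg Prod.fst h0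
          exact (Fin.castSucc_injective _ h1).symm
        · simp
      · intro p _ hp
        rw [if_neg (by exact fun h0 => hab (Equiv.injective _ h0)), zero_add, Finset.sum_eq_zero]
        intro i _
        refine if_neg fun h0 => hp ?_
        have h1 : p = i.castSucc := by simpa [← ha] using congrArg Prod.fst h0
        have h2 : p.succAbove (τ j) = i.succ := by
          simpa [← hj] using congrArg Prod.snd h0
        rw [h1, ← Fin.succAbove_castSucc_self i] at h2
        rw [h1, Fin.succAbove_right_injective h2]
      · simp

end Combinatorics

/-! ### The group of vertex and half-edge relabelings -/

section HalfEdges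

/-- A permutation of edges together with the choice of the edges whose ends are exchanged. -/
def flipPerm {E : Type*} (p : Equiv.Perm E) (s : E → Bool) : Equiv.Perm (E × Bool) where
  toFun h := (p h.1, xor (s h.1) h.2)
  invFun h := (p.symm h.1, xor (s (p.symm h.1)) h.2)
  left_inv h := by simp
  right_inv h := by simp

/-- Commuting with the exchange of the two ends makes `π` determined by its values at `(e, false)`.
Two edges with the same image edge would have a common half-edge in their images, so the induced map
on edges is injective, hence bijective by finiteness. -/
theorem exists_eq_flipPerm {E : Type*} [Finite E] (π : Equiv.Perm (E × Bool))
    (h : ∀ e b, π (e, !b) = ((π (e, b)).1, !(π (e, b)).2)) :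
    ∃ p s, π = flipPerm p s := by
  have hinj : Function.Injective fun e => (π (e, false)).1 := by
    intro i j hij
    have hij : (π (i, false)).1 = (π (j, false)).1 := hij
    by_cases h2 : (π (i, false)).2 = (π (j, false)).2
    · exact congrArg Prod.fst (π.injective (Prod.ext hij h2))
    · have h3 : π (i, false) = π (j, true) := by
        rw [show true = !false from rfl, h]
        exact Prod.ext hij (Bool.eq_not_of_ne h2)
      exact congrArg Prod.fst (π.injective h3)
  refine ⟨Equiv.ofBijective _ (Finite.injective_iff_bijective.1 hinj),
    fun e => (π (e, false)).2, ?_⟩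
  ext1 ⟨e, b⟩
  cases b
  · simp [flipPerm]
  · have := h e false
    rw [Bool.not_false] at this
    rw [this]
    simp [flipPerm]

/-- The permutations of vertices and half-edges that map edges to edges. -/
def relabelings (v : ℕ) (E : Type*) : Subgroup (Equiv.Perm (Fin v) × Equiv.Perm (E × Bool)) where
  carrier := {p | ∀ e b, p.2 (e, !b) = ((p.2 (e, b)).1, !(p.2 (e, b)).2)}
  one_mem' e b := rfl
  mul_mem' {p q} hp hq e b := by
    change p.2 (q.2 _) = ((p.2 (q.2 _)).1, !(p.2 (q.2 _)).2)
    rw [hq, hp]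
  inv_mem' {p} hp e b := by
    change p.2⁻¹ _ = _
    rw [Equiv.Perm.inv_eq_iff_eq, hp]
    simp

theorem flipPerm_mem {v : ℕ} {E : Type*} (σ : Equiv.Perm (Fin v)) (p : Equiv.Perm E)
    (s : E → Bool) : (σ, flipPerm p s) ∈ relabelings v E := by
  intro e b
  simp [flipPerm]

theorem card_relabelings (v : ℕ) (E : Type*) [Fintype E] :
    Nat.card (relabelings v E) =
      v.factorial * (2 ^ Fintype.card E * (Fintype.card E).factorial) := by
  classical
  have : Function.Bijective fun q : Equiv.Perm (Fin v) × (E → Bool) × Equiv.Perm E =>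
      (⟨(q.1, flipPerm q.2.2 q.2.1), flipPerm_mem _ _ _⟩ : relabelings v E) := by
    constructor
    · rintro ⟨σ, s, p⟩ ⟨σ', s', p'⟩ h
      have h := congrArg Subtype.val h
      have h1 : σ = σ' := congrArg Prod.fst h
      have h2 : flipPerm p s = flipPerm p' s' := congrArg Prod.snd h
      have h3 (e : E) : p e = p' e ∧ s e = s' e := by
        simpa [flipPerm] using congrArg (· (e, false)) h2
      rw [h1, Equiv.ext fun e => (h3 e).1, funext fun e => (h3 e).2]
    · rintro ⟨⟨σ, π⟩, h⟩
      obtain ⟨p, s, rfl⟩ := exists_eq_flipPerm π h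
      exact ⟨(σ, s, p), rfl⟩
  rw [← Nat.card_eq_of_bijective _ this]
  simp [Fintype.card_perm]

/-- The attachments of the half-edges of the edges in `E` and of `n` external edges to vertices. -/
def Attachment (v n : ℕ) (E : Type*) : Type _ := (E × Bool → Fin v) × (Fin n → Fin v)

instance {v n : ℕ} {E : Type*} : MulAction (relabelings v E) (Attachment v n E) where
  smul k x := (fun h => k.1.1 (x.1 (k.1.2⁻¹ h)), fun j => k.1.1 (x.2 j))
  one_smul _ := rfl
  mul_smul k k' x := by
    refine Prod.ext (funext fun h => ?_) rfl
    change k.1.1 (k'.1.1 (x.1 ((k.1.2 * k'.1.2)⁻¹ h))) =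
      k.1.1 (k'.1.1 (x.1 (k'.1.2⁻¹ (k.1.2⁻¹ h))))
    rw [mul_inv_rev, Equiv.Perm.mul_apply]

theorem smul_eq_iff {v n : ℕ} {E : Type*} (k : relabelings v E) (x y : Attachment v n E) :
    k • x = y ↔ (∀ h, y.1 (k.1.2 h) = k.1.1 (x.1 h)) ∧ ∀ j, y.2 j = k.1.1 (x.2 j) := by
  constructor
  · rintro rfl
    refine ⟨fun h => ?_, fun j => rfl⟩
    change k.1.1 (x.1 (k.1.2⁻¹ (k.1.2 h))) = _
    simp
  · rintro ⟨h1, h2⟩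
    refine Prod.ext (funext fun h => ?_) (funext fun j => (h2 j).symm)
    change k.1.1 (x.1 (k.1.2⁻¹ h)) = y.1 h
    rw [← h1]
    simp

end HalfEdges

/-! ### Isomorphism classes as orbits, symmetry factors as stabilizers -/

section Graphs

/-- The graph with oriented edges `e i` and external edges at the vertices `leg k`. -/
def graphOf {E : Type*} [Fintype E] {v n : ℕ} (e : E → Fin v × Fin v) (leg : Fin n → Fin v) :
    OrderedGraph v n :=
  ⟨Finset.univ.val.map fun i => s((e i).1, (e i).2), leg⟩

theorem graphOf_comp_equiv {E F : Type*} [Fintype E] [Fintype F] {v n : ℕ} (ε : F ≃ E)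
    (e : E → Fin v × Fin v) (leg : Fin n → Fin v) :
    graphOf (fun i => e (ε i)) leg = graphOf e leg := by
  ext1
  · change _ = Multiset.map _ Finset.univ.val
    rw [← Finset.map_univ_equiv ε, Finset.map_val, Multiset.map_map]
    rfl
  · rfl

/-- Equal multiplicities mean that `f` and `g` have equinumerous fibres, which can be matched one by
one. -/
theorem exists_equiv_of_map_univ_eq {E α : Type*} [Fintype E] {f g : E → α}
    (h : Finset.univ.val.map f = Finset.univ.val.map g) :
    ∃ p : Equiv.Perm E, ∀ i, g (p i) = f i := by
  classical
  have key (c : α) : Fintype.card {i // f i = c} = Fintype.card {i // g i = c} := by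
    have := congrArg (Multiset.count c) h
    rw [Multiset.count_map, Multiset.count_map] at this
    rw [Fintype.card_subtype, Fintype.card_subtype]
    simpa [Finset.card_def, eq_comm] using this
  exact ⟨Equiv.ofFiberEquiv fun c => Fintype.equivOfCardEq (key c),
    fun i => Equiv.ofFiberEquiv_map _ i⟩

/-- The graph determined by the attachments of half-edges and external edges. -/
def Attachment.graph {v n : ℕ} {E : Type*} [Fintype E] (x : Attachment v n E) :
    OrderedGraph v n :=
  graphOf (fun i => (x.1 (i, false), x.1 (i, true))) x.2

theorem mem_orbit_iff {v n : ℕ} {E : Type*} [Fintype E] (x y : Attachment v n E) :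
    y ∈ MulAction.orbit (relabelings v E) x ↔ x.graph.Iso y.graph := by
  constructor
  · rintro ⟨⟨⟨σ, π⟩, hk⟩, h⟩
    obtain ⟨h1, h2⟩ := (smul_eq_iff _ _ _).1 h
    obtain ⟨p, s, rfl⟩ := exists_eq_flipPerm π hk
    refine ⟨σ, ?_, h2⟩
    have h3 : y.graph.edges = (graphOf (n := n)
      (fun i => (y.1 (p i, false), y.1 (p i, true))) y.2).edges :=
        (congrArg OrderedGraph.edges (graphOf_comp_equiv p
          (fun i => (y.1 (i, false), y.1 (i, true))) y.2)).symm
    rw [h3]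
    simp only [graphOf, Attachment.graph, Multiset.map_map]
    refine Multiset.map_congr rfl fun i _ => ?_
    have ht := h1 (i, true)
    have hf := h1 (i, false)
    simp only [flipPerm, Equiv.coe_fn_mk, Bool.xor_true, Bool.xor_false] at ht hf
    simp only [Function.comp_apply, Sym2.map_mk, ← ht, ← hf]
    cases s i
    · rfl
    · exact Sym2.eq_swap
  · rintro ⟨σ, h1, h2⟩
    simp only [Attachment.graph, graphOf, Multiset.map_map] at h1
    obtain ⟨p, hp⟩ := exists_equiv_of_map_univ_eq h1.symm
    classical
    -- An edge is reversed exactly when its first end does not already land on the first end of its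
    -- image.
    refine ⟨⟨_, flipPerm_mem σ p fun i => !decide (y.1 (p i, false) = σ (x.1 (i, false)))⟩,
      (smul_eq_iff _ _ _).2 ⟨?_, h2⟩⟩
    rintro ⟨i, b⟩
    have hi := hp i
    simp only [Function.comp_apply, Sym2.map_mk, Sym2.eq_iff] at hi
    by_cases hc : y.1 (p i, false) = σ (x.1 (i, false))
    · cases b <;> simp [flipPerm, hc]
      obtain hi | hi := hi
      · exact hi.2
      · rw [hi.2, ← hc, hi.1]
    · have hi := hi.resolve_left fun h => hc h.1
      cases b <;> simp [flipPerm, hc]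
      · exact hi.2
      · exact hi.1

theorem mk_inf_sup {α : Type*} [LinearOrder α] (z : Sym2 α) : s(z.inf, z.sup) = z := by
  induction z with
  | _ a b =>
    rw [Sym2.inf_mk, Sym2.sup_mk]
    obtain h | h := le_total a b
    · rw [inf_eq_left.2 h, sup_eq_right.2 h]
    · rw [inf_eq_right.2 h, sup_eq_left.2 h, Sym2.eq_swap]

namespace OrderedGraph

variable {v n : ℕ}

/-- The attachments of the half-edges and external edges of a graph. -/
def attachment (Γ : OrderedGraph v n) : Attachment v n Γ.edges.ToType := (Γ.endpoint, Γ.leg)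

theorem graph_attachment (Γ : OrderedGraph v n) : Γ.attachment.graph = Γ := by
  ext1
  · refine Eq.trans ?_ Γ.edges.map_univ_coe
    refine Multiset.map_congr rfl fun i _ => ?_
    exact mk_inf_sup _
  · rfl

theorem card_stabilizer (Γ : OrderedGraph v n) :
    Nat.card (MulAction.stabilizer (relabelings v Γ.edges.ToType) Γ.attachment) =
      Γ.symmetryFactor := by
  refine Nat.card_congr
    { toFun := fun k => ⟨k.1.1, k.1.2, ?_, ?_⟩
      invFun := fun p => ⟨⟨p.1, p.2.1⟩, ?_⟩
      left_inv := fun _ => rfl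
      right_inv := fun _ => rfl }
  · exact ((smul_eq_iff _ _ _).1 (MulAction.mem_stabilizer_iff.1 k.2)).1
  · exact fun j => (((smul_eq_iff _ _ _).1 (MulAction.mem_stabilizer_iff.1 k.2)).2 j).symm
  · exact MulAction.mem_stabilizer_iff.2
      ((smul_eq_iff _ _ _).2 ⟨p.2.2.1, fun j => (p.2.2.2 j).symm⟩)

/-- Orbit-stabilizer for the action of `relabelings` on the attachment of `Γ`, with the orbit
rewritten in terms of sequences by numbering the edges. -/
theorem card_iso_mul_symmetryFactor (Γ : OrderedGraph v n) {m : ℕ}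
    (hm : Multiset.card Γ.edges = m) :
    Nat.card {q : (Fin m → Fin v × Fin v) × (Fin n → Fin v) // Γ.Iso (graphOf q.1 q.2)} *
      Γ.symmetryFactor = v.factorial * (2 ^ m * m.factorial) := by
  classical
  have hE : Fintype.card Γ.edges.ToType = m := by rw [← hm]; exact Γ.edges.card_coe
  let ε : Fin m ≃ Γ.edges.ToType := (Fintype.equivFinOfCardEq hE).symm
  have hc : Nat.card (MulAction.orbit (relabelings v Γ.edges.ToType) Γ.attachment) =
      Nat.card {q : (Fin m → Fin v × Fin v) × (Fin n → Fin v) //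
        Γ.Iso (graphOf q.1 q.2)} := by
    let Ψ : Attachment v n Γ.edges.ToType ≃ (Fin m → Fin v × Fin v) × (Fin n → Fin v) :=
      { toFun := fun y => (fun i => (y.1 (ε i, false), y.1 (ε i, true)), y.2)
        invFun := fun q => (fun h => if h.2 then (q.1 (ε.symm h.1)).2 else (q.1 (ε.symm h.1)).1,
          q.2)
        left_inv := fun y => by
          refine Prod.ext (funext ?_) rfl
          rintro ⟨i, b⟩
          cases b <;> simp
        right_inv := fun q => by simp }
    refine Nat.card_congr (Ψ.subtypeEquiv fun y => ?_)
    rw [mem_orbit_iff, graph_attachment]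
    have : graphOf (Ψ y).1 (Ψ y).2 = y.graph :=
      graphOf_comp_equiv ε (fun i => (y.1 (i, false), y.1 (i, true))) y.2
    rw [this]
  have : Finite (Attachment v n Γ.edges.ToType) :=
    inferInstanceAs (Finite ((Γ.edges.ToType × Bool → Fin v) × (Fin n → Fin v)))
  have := Fintype.ofFinite (MulAction.orbit (relabelings v Γ.edges.ToType) Γ.attachment)
  have := Fintype.ofFinite (relabelings v Γ.edges.ToType)
  have := Fintype.ofFinite (MulAction.stabilizer (relabelings v Γ.edges.ToType) Γ.attachment)
  have h := MulAction.card_orbit_mul_card_stabilizer_eq_card_group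
    (relabelings v Γ.edges.ToType) Γ.attachment
  rw [← Nat.card_eq_fintype_card, ← Nat.card_eq_fintype_card, ← Nat.card_eq_fintype_card,
    hc, card_stabilizer, card_relabelings, hE] at h
  exact h

theorem connected_iff (Γ : OrderedGraph v n) :
    Γ.Connected ↔ 0 < v ∧ ∀ c : Fin v → Prop,
      (∀ a b, s(a, b) ∈ Γ.edges → (c a ↔ c b)) → ∀ x y, c x ↔ c y := by
  rw [Connected, SimpleGraph.connected_iff, and_comm, Fin.pos_iff_nonempty.symm]
  refine and_congr_right fun _ => ⟨fun h c hc x y => ?_, fun h x y => ?_⟩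
  · obtain ⟨p⟩ := h x y
    induction p with
    | nil => rfl
    | cons hadj _ ih =>
      rw [toSimpleGraph, SimpleGraph.fromEdgeSet_adj] at hadj
      exact (hc _ _ hadj.1).trans ih
  -- Being reachable from `x` is a property constant along edges.
  · refine (h (Γ.toSimpleGraph.Reachable x) (fun a b hab => ?_) x y).1 (SimpleGraph.Reachable.refl x)
    by_cases hne : a = b
    · rw [hne]
    · have hadj : Γ.toSimpleGraph.Adj a b := by
        rw [toSimpleGraph, SimpleGraph.fromEdgeSet_adj]
        exact ⟨hab, hne⟩
      exact ⟨fun h => h.trans hadj.reachable, fun h => h.trans hadj.symm.reachable⟩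

theorem connected_graphOf {E : Type*} [Fintype E] {e : E → Fin v × Fin v} {leg : Fin n → Fin v} :
    (graphOf e leg).Connected ↔ EdgeConnected e := by
  rw [connected_iff]
  refine and_congr_right fun _ => forall_congr' fun c => imp_congr_left ⟨fun h i => ?_,
    fun h a b hab => ?_⟩
  · exact h _ _ (Multiset.mem_map_of_mem _ (Finset.mem_univ i))
  · obtain ⟨i, _, hi⟩ := Multiset.mem_map.1 hab
    obtain ⟨rfl, rfl⟩ | ⟨rfl, rfl⟩ := Sym2.eq_iff.1 hi
    · exact h i
    · exact (h i).symm

theorem Iso.connected {Γ Γ' : OrderedGraph v n} (h : Γ.Iso Γ') (hΓ : Γ.Connected) :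
    Γ'.Connected := by
  obtain ⟨σ, hσ, _⟩ := h
  rw [connected_iff] at hΓ ⊢
  refine ⟨hΓ.1, fun c hc x y => ?_⟩
  have := hΓ.2 (fun a => c (σ a)) (fun a b hab => hc _ _ ?_) (σ.symm x) (σ.symm y)
  · simpa using this
  · rw [hσ]
    exact Multiset.mem_map_of_mem (Sym2.map σ) hab

theorem Connected.loopNumber_eq {Γ : OrderedGraph v n} (h : Γ.Connected) :
    Γ.loopNumber = (Multiset.card Γ.edges : ℤ) - v + 1 := by
  have h : Γ.toSimpleGraph.Connected := h
  have := h.nonempty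
  have := h.preconnected.subsingleton_connectedComponent
  have : Nonempty Γ.toSimpleGraph.ConnectedComponent := inferInstance
  rw [loopNumber, Nat.card_unique, Nat.cast_one]

theorem Iso.trans_map {Γ : OrderedGraph v n} {E : Type*} [Fintype E] {e : E → Fin v × Fin v}
    {leg : Fin n → Fin v} (h : Γ.Iso (graphOf e leg)) (σ : Equiv.Perm (Fin v)) :
    Γ.Iso (graphOf (fun i => Prod.map σ σ (e i)) fun k => σ (leg k)) := by
  obtain ⟨τ, h1, h2⟩ := h
  refine ⟨τ.trans σ, ?_, fun k => congrArg σ (h2 k)⟩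
  have h3 : (graphOf (n := n) (fun i => Prod.map σ σ (e i)) fun k => σ (leg k)).edges =
      (graphOf e leg).edges.map (Sym2.map σ) := by
    simp only [graphOf, Multiset.map_map]
    rfl
  rw [h3, h1, Multiset.map_map, Equiv.coe_trans, Sym2.map_comp]

end OrderedGraph

end Graphs

/-! ### From edge sequences to graphs and their total weights -/

/-- The symmetry of `g` makes the orientation of an edge immaterial, so that sequences with the same
underlying graph have the same tensor. -/
theorem R_inf_sup {V : Type*} [AddCommGroup V] [Module ℂ V] {g : V ⊗[ℂ] V}
    (hg : TensorProduct.comm ℂ V V g = g) {v : ℕ} (a b : Fin v) :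
    R g s(a, b).inf s(a, b).sup = R g a b := by
  rw [Sym2.inf_mk, Sym2.sup_mk]
  obtain h | h := le_total a b
  · rw [inf_eq_left.2 h, sup_eq_right.2 h]
  · rw [inf_eq_right.2 h, sup_eq_left.2 h, ← R_comm, hg]

theorem toTensor_graphOf {V : Type*} [AddCommGroup V] [Module ℂ V] {g : V ⊗[ℂ] V}
    (hg : TensorProduct.comm ℂ V V g = g) {m v n : ℕ} (f : Fin n → V)
    (e : Fin m → Fin v × Fin v) (leg : Fin n → Fin v) :
    (graphOf e leg).toTensor g f = edgeTensor g f e leg := by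
  simp only [OrderedGraph.toTensor, graphOf, edgeTensor, Multiset.map_map, Function.comp_apply,
    R_inf_sup hg]
  rfl

/-- The weighted sum of all vertex-ordered graphs with `m` internal edges, `v` vertices and `n`
external edges. -/
def weightedGraphs (m v n : ℕ) : OrderedGraph v n →₀ ℚ :=
  ∑ q : (Fin m → Fin v × Fin v) × (Fin n → Fin v),
    Finsupp.single (graphOf q.1 q.2) (weight m v q.1)

theorem sum_weightedGraphs {M : Type*} [AddCommMonoid M] (m v n : ℕ)
    (F : OrderedGraph v n → ℚ → M) (h_zero : ∀ Γ, F Γ 0 = 0)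
    (h_add : ∀ Γ a b, F Γ (a + b) = F Γ a + F Γ b) :
    (weightedGraphs m v n).sum F =
      ∑ q : (Fin m → Fin v × Fin v) × (Fin n → Fin v), F (graphOf q.1 q.2) (weight m v q.1) := by
  rw [weightedGraphs, ← Finsupp.sum_finsetSum_index h_zero h_add]
  exact Finset.sum_congr rfl fun q _ => Finsupp.sum_single_index (h_zero _)

theorem connected_and_card_of_mem_support_weightedGraphs {m v n : ℕ} {Γ : OrderedGraph v n}
    (h : Γ ∈ (weightedGraphs m v n).support) :
    Γ.Connected ∧ Multiset.card Γ.edges = m := by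
  classical
  rw [Finsupp.mem_support_iff, weightedGraphs, Finsupp.finsetSum_apply] at h
  obtain ⟨q, _, hq⟩ := Finset.exists_ne_zero_of_sum_ne_zero h
  rw [Finsupp.single_apply] at hq
  obtain ⟨rfl, hw⟩ := ite_ne_right_iff.1 hq
  exact ⟨OrderedGraph.connected_graphOf.2 (edgeConnected_of_weight_ne_zero hw), by simp [graphOf]⟩

theorem unorderedWeight_weightedGraphs {m v n : ℕ} {Γ : OrderedGraph v n} (hΓ : Γ.Connected)
    (hm : Multiset.card Γ.edges = m) :
    Γ.unorderedWeight (weightedGraphs m v n) = 1 / (Γ.symmetryFactor : ℚ) := by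
  classical
  have h1 : Γ.unorderedWeight (weightedGraphs m v n) =
      ∑ q : (Fin m → Fin v × Fin v) × (Fin n → Fin v),
        if Γ.Iso (graphOf q.1 q.2) then weight m v q.1 else 0 := by
    rw [OrderedGraph.unorderedWeight, Finset.sum_filter]
    refine Eq.trans ?_ (sum_weightedGraphs m v n (fun Γ' c => if Γ.Iso Γ' then c else 0)
      (fun _ => ite_self _) fun Γ' a b => ?_)
    · exact Finset.sum_congr rfl fun _ _ => by congr
    · split_ifs <;> simp
  -- The set of sequences isomorphic to `Γ` is stable under `σ`, so relabeling the argument of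
  -- `weight` permutes the summands. Summing over all `σ` then brings in `sum_weight_map`.
  have h2 (σ : Equiv.Perm (Fin v)) : Γ.unorderedWeight (weightedGraphs m v n) =
      ∑ q : (Fin m → Fin v × Fin v) × (Fin n → Fin v),
        if Γ.Iso (graphOf q.1 q.2) then weight m v (fun i => Prod.map σ σ (q.1 i)) else 0 := by
    let Φ : (Fin m → Fin v × Fin v) × (Fin n → Fin v) ≃
        (Fin m → Fin v × Fin v) × (Fin n → Fin v) :=
      (Equiv.arrowCongr (Equiv.refl _) (σ.prodCongr σ)).prodCongr
        (Equiv.arrowCongr (Equiv.refl _) σ)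
    rw [h1, ← Φ.sum_comp]
    refine Finset.sum_congr rfl fun q _ => if_congr ⟨fun h => ?_, fun h => h.trans_map σ⟩ rfl rfl
    have := h.trans_map σ⁻¹
    simpa [Φ, Prod.map, Function.comp_def] using this
  have h3 : (v.factorial : ℚ) * Γ.unorderedWeight (weightedGraphs m v n) =
      (Nat.card {q : (Fin m → Fin v × Fin v) × (Fin n → Fin v) //
        Γ.Iso (graphOf q.1 q.2)} : ℚ) * (1 / (2 ^ m * (m.factorial : ℚ))) := by
    have h4 : ∑ _σ : Equiv.Perm (Fin v), Γ.unorderedWeight (weightedGraphs m v n) =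
        (v.factorial : ℚ) * Γ.unorderedWeight (weightedGraphs m v n) := by
      simp [Fintype.card_perm]
    rw [← h4, Finset.sum_congr rfl fun σ _ => h2 σ, Finset.sum_comm, Nat.card_eq_fintype_card,
      Fintype.card_subtype, ← nsmul_eq_mul, ← Finset.sum_const, Finset.sum_filter]
    refine Finset.sum_congr rfl fun q _ => ?_
    split_ifs with hq
    · exact sum_weight_map (OrderedGraph.connected_graphOf.1 (hq.connected hΓ))
    · simp
  have h5 := congrArg (Nat.cast (R := ℚ)) (Γ.card_iso_mul_symmetryFactor hm)
  push_cast at h5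
  have h6 : (v.factorial : ℚ) ≠ 0 := by positivity
  have h7 : (2 ^ m * (m.factorial : ℚ)) ≠ 0 := by positivity
  -- The symmetry factor divides the nonzero group order in `h5`.
  have h8 : (Γ.symmetryFactor : ℚ) ≠ 0 := right_ne_zero_of_mul (h5 ▸ mul_ne_zero h6 h7)
  rw [eq_div_iff h8]
  apply mul_left_cancel₀ h6
  rw [← mul_assoc, h3, mul_one, mul_right_comm, h5, mul_assoc, mul_one_div_cancel h7, mul_one]

end FieldGraph

end
open FieldGraph in
theorem theorem1 (l v n : ℕ) (hv : 1 ≤ v) :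
    ∃ w : OrderedGraph v n →₀ ℚ,
      (∀ (V : Type*) [AddCommGroup V] [Module ℂ V] (g : V ⊗[ℂ] V)
          (_ : TensorProduct.comm ℂ V V g = g) (X : Type*) (φ : X → V) (x : Fin n → X),
        Omega g l v (∏ k, SymmetricAlgebra.ι ℂ V (φ (x k))) =
          w.sum fun Γ c => (c : ℂ) • Γ.toTensor g (φ ∘ x)) ∧
      (∀ Γ ∈ w.support, Γ.Connected ∧ Γ.loopNumber = l) ∧
      (∀ Γ : OrderedGraph v n, Γ.Connected → Γ.loopNumber = l →
        Γ.unorderedWeight w = 1 / (Γ.symmetryFactor : ℚ)) := by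
  -- A connected graph with `l` loops and `v` vertices has `l + v - 1` internal edges; the
  -- subtraction is not truncated because `1 ≤ v`.
  refine ⟨weightedGraphs (l + v - 1) v n, ?_, fun Γ h => ?_, fun Γ hΓ hl => ?_⟩
  · intro V _ _ g hg X φ x
    rw [sum_weightedGraphs _ _ _ _ (by simp) (by simp [add_smul]),
      Omega_prod g (fun k => φ (x k)) (l + v - 1) l v (by omega), if_neg (by omega), weightedSum,
      Fintype.sum_prod_type]
    simp only [toTensor_graphOf hg]
    rfl
  · obtain ⟨hc, hm⟩ := connected_and_card_of_mem_support_weightedGraphs h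
    refine ⟨hc, ?_⟩
    rw [hc.loopNumber_eq, hm]
    omega
  · refine unorderedWeight_weightedGraphs hΓ ?_
    rw [hΓ.loopNumber_eq] at hl
    omega
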